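/- Call a sequence of positive integers $(a(n))_{n\ge 1}$, extended by $a(k)=0$ for $k\le 0$, \emph{admissible} if it is nondecreasing on $n\ge 1$ and $$a\bigl(a(n)+a(n-1)+a(n-2)+a(n-3)\bigr)=n\qquad\text{for all } n\ge 1 .$$ The \emph{almost Golomb sequence of order $4$} is the greedy (lexicographically least) admissible sequence: for every $n\ge 2$, $a(n)\le b(n)$ for every admissible sequence $b$ with $b(k)=a(k)$ for all $k<n$. (It begins $1,2,2,2,3,3,4,4,5,6,6,7,7,8,8,9,\dots$) \textbf{Theorem.} The almost Golomb sequence $(a(n))$ of order $4$ exists and is unique. Put $A_k=a(4^k)$. Then for all $k\ge 3$ $$A_{k+1}=4A_k-2,\qquad A_k=\tfrac{25}{48}\,4^k+\tfrac23 .$$ Moreover, as $k\to\infty$, $$\frac{a(4^k)}{4^k}\to\frac{25}{48},\qquad \frac{a(7\cdot 4^k)}{7\cdot 4^k}\to\frac{10}{21}.$$ These limits are distinct, so both are limit points of the sequence $a(n)/n$, and $a(n)/n$ does not converge. -/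

import Mathlib

open Filter Topology

/-- The window sum `a(n) + a(n-1) + ⋯ + a(n-r+1)` of the `r` most recent terms. -/
def windowSum (r : ℕ) (a : ℤ → ℤ) (n : ℤ) : ℤ :=
  ∑ j ∈ Finset.range r, a (n - (j : ℤ))

/-- `a` restricted to `n ≥ 1` is a nondecreasing sequence of positive integers, it is extended by
`0` to `n ≤ 0`, and it satisfies `a(a(n) + a(n-1) + ⋯ + a(n-r+1)) = n` for all `n ≥ 1`. -/
structure IsGolombAdmissible (r : ℕ) (a : ℤ → ℤ) : Prop where
  eq_zero : ∀ k : ℤ, k ≤ 0 → a k = 0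
  pos : ∀ n : ℤ, 1 ≤ n → 0 < a n
  mono : ∀ n : ℤ, 1 ≤ n → a n ≤ a (n + 1)
  window : ∀ n : ℤ, 1 ≤ n → a (windowSum r a n) = n

/-- The almost Golomb sequence of order `r`: the admissible sequence chosen greedily. For every
`n ≥ 2`, the value `a(n)` is the least one compatible with the earlier values, that is, no
admissible sequence with the same terms before `n` has a smaller `n`-th term. -/
structure IsAlmostGolomb (r : ℕ) (a : ℤ → ℤ) : Prop where
  admissible : IsGolombAdmissible r a
  minimal : ∀ n : ℤ, 2 ≤ n → ∀ b : ℤ → ℤ, IsGolombAdmissible r b →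
    (∀ k : ℤ, k < n → b k = a k) → a n ≤ b n

/-! With w the window sum, the sequence is the generalized inverse of w: w(a(m)) ≤ m < w(a(m)+1) for
m ≥ 3 (`golombFour_bracket`). As w is strictly increasing on n ≥ 0, this yields a(w(n)) = n; the
lower bound also forces greedy minimality.

The bracket also computes distant values from local ones. A suitable pattern around a(n) = A fixes
the terms near index 4A, and these reproduce the pattern around a(4n) = 4A - 2
(`IsGolombWindow.four_mul`). The map A ↦ 4A - 2 multiplies A - 2/3 by 4, so a(n·4^k)/(n·4^k) → (A -
2/3)/n. The seeds (16, 9) and (28, 14) give 25/48 and 10/21. -/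

/-- The slow recursion for the almost Golomb sequence of order `4`: the sequence steps up exactly
when the next index reaches the window sum of the next value. -/
def golombFourNat : ℕ → ℕ
  | 0 => 0
  | 1 => 1
  | 2 => 2
  | 3 => 2
  | 4 => 2
  | m + 5 =>
    if h : golombFourNat (m + 4) + 1 ≤ m + 4 then
      if golombFourNat (golombFourNat (m + 4) + 1) + golombFourNat (golombFourNat (m + 4))
          + golombFourNat (golombFourNat (m + 4) - 1)
          + golombFourNat (golombFourNat (m + 4) - 2) ≤ m + 5 then
        golombFourNat (m + 4) + 1
      else golombFourNat (m + 4)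
    else golombFourNat (m + 4)
  termination_by n => n
  decreasing_by all_goals omega

/-- Shows that the guard in the recursion, present only for termination, always holds. -/
theorem golombFourNat_add_two_le (m : ℕ) : golombFourNat (m + 4) + 2 ≤ m + 4 := by
  induction m with
  | zero => simp [golombFourNat]
  | succ m ih =>
    rw [show m + 1 + 4 = m + 5 from rfl, golombFourNat]
    split_ifs <;> omega

theorem golombFourNat_succ (m : ℕ) : golombFourNat (m + 5) =
    if golombFourNat (golombFourNat (m + 4) + 1) + golombFourNat (golombFourNat (m + 4))
        + golombFourNat (golombFourNat (m + 4) - 1)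
        + golombFourNat (golombFourNat (m + 4) - 2) ≤ m + 5 then
      golombFourNat (m + 4) + 1
    else golombFourNat (m + 4) := by
  have h := golombFourNat_add_two_le m
  rw [golombFourNat, dif_pos (by omega)]

/-- The almost Golomb sequence of order `4`, extended by zero. -/
def golombFour (n : ℤ) : ℤ := golombFourNat n.toNat

theorem golombFour_of_nonpos {n : ℤ} (h : n ≤ 0) : golombFour n = 0 := by
  simp [golombFour, Int.toNat_of_nonpos h, golombFourNat]

theorem golombFour_one : golombFour 1 = 1 := by simp [golombFour, golombFourNat]

theorem golombFour_two : golombFour 2 = 2 := by simp [golombFour, golombFourNat]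

theorem golombFour_three : golombFour 3 = 2 := by simp [golombFour, golombFourNat]

theorem golombFour_four : golombFour 4 = 2 := by simp [golombFour, golombFourNat]

theorem windowSum_four (a : ℤ → ℤ) (n : ℤ) :
    windowSum 4 a n = a n + a (n - 1) + a (n - 2) + a (n - 3) := by
  simp [windowSum, Finset.sum_range_succ]

theorem windowSum_four_succ (a : ℤ → ℤ) (n : ℤ) :
    windowSum 4 a (n + 1) = windowSum 4 a n + a (n + 1) - a (n - 3) := by
  rw [windowSum_four, windowSum_four, show n + 1 - 1 = n by ring, show n + 1 - 2 = n - 1 by ring,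
    show n + 1 - 3 = n - 2 by ring]
  ring

theorem golombFour_succ {m : ℤ} (hm : 4 ≤ m) : golombFour (m + 1) =
    if windowSum 4 golombFour (golombFour m + 1) ≤ m + 1 then golombFour m + 1
    else golombFour m := by
  obtain ⟨k, rfl⟩ : ∃ k : ℕ, m = (k : ℤ) + 4 := ⟨(m - 4).toNat, by omega⟩
  have h := golombFourNat_succ k
  have e4 : golombFour ((k : ℤ) + 4) = golombFourNat (k + 4) := by
    rw [golombFour, show ((k : ℤ) + 4).toNat = k + 4 by omega]
  have e5 : golombFour ((k : ℤ) + 4 + 1) = golombFourNat (k + 5) := by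
    rw [golombFour, show ((k : ℤ) + 4 + 1).toNat = k + 5 by omega]
  have ecoe (x : ℕ) : golombFour (x + 1) = golombFourNat (x + 1) ∧
      golombFour (x + 1 - 1) = golombFourNat x ∧
      golombFour (x + 1 - 2) = golombFourNat (x - 1) ∧
      golombFour (x + 1 - 3) = golombFourNat (x - 2) := by
    simp only [golombFour]
    rw [show ((x : ℤ) + 1).toNat = x + 1 by omega, show ((x : ℤ) + 1 - 1).toNat = x by omega,
      show ((x : ℤ) + 1 - 2).toNat = x - 1 by omega, show ((x : ℤ) + 1 - 3).toNat = x - 2 by omega]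
    exact ⟨rfl, rfl, rfl, rfl⟩
  obtain ⟨h1, h2, h3, h4⟩ := ecoe (golombFourNat (k + 4))
  rw [e4, e5, windowSum_four, h, h1, h2, h3, h4]
  split_ifs <;> (push_cast at *; omega)

/-! ### Slow growth and the bracket by window sums -/

theorem golombFour_step (n : ℤ) :
    golombFour n ≤ golombFour (n + 1) ∧ golombFour (n + 1) ≤ golombFour n + 1 := by
  rcases lt_or_ge n 0 with h | h
  · simp [golombFour_of_nonpos (show n ≤ 0 by omega),
      golombFour_of_nonpos (show n + 1 ≤ 0 by omega)]
  rcases lt_or_ge n 4 with h4 | h4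
  · interval_cases n <;>
      norm_num [golombFour_of_nonpos, golombFour_one, golombFour_two, golombFour_three,
        golombFour_four]
  · rw [golombFour_succ h4]
    split_ifs <;> omega

theorem golombFour_mono : Monotone golombFour :=
  monotone_int_of_le_succ fun n => (golombFour_step n).1

theorem golombFour_add_two_le {m : ℤ} (hm : 4 ≤ m) : golombFour m + 2 ≤ m := by
  induction m, hm using Int.leInduction with
  | base => norm_num [golombFour_four]
  | succ m _ ih => linarith [(golombFour_step m).2]

theorem windowSum_golombFour_succ_le (n : ℤ) :
    windowSum 4 golombFour (n + 1) ≤ windowSum 4 golombFour n + 4 := by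
  have h0 := (golombFour_step (n - 3)).2
  have h1 := (golombFour_step (n - 2)).2
  have h2 := (golombFour_step (n - 1)).2
  have h3 := (golombFour_step n).2
  rw [show n - 3 + 1 = n - 2 by ring] at h0
  rw [show n - 2 + 1 = n - 1 by ring] at h1
  rw [show n - 1 + 1 = n by ring] at h2
  rw [windowSum_four_succ]
  linarith

theorem golombFour_five : golombFour 5 = 3 := by
  have h := golombFour_succ (m := 4) le_rfl
  norm_num [windowSum_four, golombFour_of_nonpos, golombFour_one, golombFour_two,
    golombFour_three, golombFour_four] at h
  exact h

theorem golombFour_six : golombFour 6 = 3 := by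
  have h := golombFour_succ (m := 5) (by norm_num)
  norm_num [windowSum_four, golombFour_of_nonpos, golombFour_one, golombFour_two,
    golombFour_three, golombFour_four, golombFour_five] at h
  exact h

theorem golombFour_bracket {m : ℤ} (hm : 3 ≤ m) :
    windowSum 4 golombFour (golombFour m) ≤ m ∧
      m < windowSum 4 golombFour (golombFour m + 1) := by
  induction m using Int.strongRec (m := 7) with
  | lt m h =>
    interval_cases m <;>
      norm_num [windowSum_four, golombFour_of_nonpos, golombFour_one, golombFour_two,
        golombFour_three, golombFour_four, golombFour_five, golombFour_six]
  | ge m h ih =>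
    obtain ⟨k, rfl⟩ : ∃ k, m = k + 1 := ⟨m - 1, by ring⟩
    have hk := ih k (by omega) (by omega)
    -- If the sequence steps up at k + 1, then w(a(k)+1) = k + 1, so strict growth of w here gives
    -- the new upper bound.
    have hlt : windowSum 4 golombFour (golombFour k + 1)
        < windowSum 4 golombFour (golombFour k + 1 + 1) := by
      have h2 := golombFour_add_two_le (show 4 ≤ k by omega)
      have hge : 2 ≤ golombFour k := by
        have := golombFour_mono (show 4 ≤ k by omega)
        rwa [golombFour_four] at this
      have key : golombFour (golombFour k + 1 - 3) < golombFour (golombFour k + 1 + 1) := by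
        rcases lt_or_ge (golombFour k) 5 with h5 | h5
        · generalize golombFour k = x at *
          interval_cases x <;>
            norm_num [golombFour_of_nonpos, golombFour_one, golombFour_two, golombFour_three,
              golombFour_four, golombFour_five, golombFour_six]
        · have hlow := ih (golombFour k + 1 - 3) (by omega) (by omega)
          have hhigh := ih (golombFour k + 1 + 1) (by omega) (by omega)
          -- A value v shared by two indices 4 apart would force w(v+1) > w(v) + 4, but slow growth
          -- bounds that increment by 4.
          refine lt_of_le_of_ne (golombFour_mono (by omega)) fun he => ?_
          rw [← he] at hhigh
          linarith [windowSum_golombFour_succ_le (golombFour (golombFour k + 1 - 3))]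
      rw [windowSum_four_succ _ (golombFour k + 1)]
      linarith
    rw [golombFour_succ (show 4 ≤ k by omega)]
    split_ifs <;> omega

theorem golombFour_lt_add_four {n : ℤ} (hn : -3 ≤ n) : golombFour n < golombFour (n + 4) := by
  rcases lt_or_ge n 3 with h | h
  · interval_cases n <;>
      norm_num [golombFour_of_nonpos, golombFour_one, golombFour_two, golombFour_three,
        golombFour_four, golombFour_five, golombFour_six]
  · refine lt_of_le_of_ne (golombFour_mono (by omega)) fun he => ?_
    have h2 := golombFour_bracket (show 3 ≤ n + 4 by omega)
    rw [← he] at h2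
    linarith [windowSum_golombFour_succ_le (golombFour n), (golombFour_bracket h).1]

theorem windowSum_golombFour_lt_succ {n : ℤ} (hn : 0 ≤ n) :
    windowSum 4 golombFour n < windowSum 4 golombFour (n + 1) := by
  have h := golombFour_lt_add_four (show -3 ≤ n - 3 by omega)
  rw [show n - 3 + 4 = n + 1 by ring] at h
  rw [windowSum_four_succ]
  linarith

theorem windowSum_golombFour_mono : Monotone (windowSum 4 golombFour) := by
  refine monotone_int_of_le_succ fun n => ?_
  rw [windowSum_four_succ]
  linarith [golombFour_mono (show n - 3 ≤ n + 1 by omega)]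

theorem golombFour_eq_of_bracket {m j : ℤ} (hm : 3 ≤ m)
    (h1 : windowSum 4 golombFour j ≤ m) (h2 : m < windowSum 4 golombFour (j + 1)) :
    golombFour m = j := by
  have h := golombFour_bracket hm
  rcases lt_trichotomy (golombFour m) j with hlt | heq | hgt
  · linarith [windowSum_golombFour_mono (show golombFour m + 1 ≤ j by omega)]
  · exact heq
  · linarith [windowSum_golombFour_mono (show j + 1 ≤ golombFour m by omega)]

theorem golombFour_admissible : IsGolombAdmissible 4 golombFour where
  eq_zero _ hk := golombFour_of_nonpos hk
  pos n hn := by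
    have := golombFour_mono hn
    rw [golombFour_one] at this
    omega
  mono n _ := (golombFour_step n).1
  window n hn := by
    rcases hn.eq_or_lt with rfl | hn
    · norm_num [windowSum_four, golombFour_of_nonpos, golombFour_one]
    · refine golombFour_eq_of_bracket ?_ le_rfl (windowSum_golombFour_lt_succ (by omega))
      have := windowSum_golombFour_mono (show 2 ≤ n by omega)
      norm_num [windowSum_four golombFour 2, golombFour_of_nonpos, golombFour_one,
        golombFour_two] at this
      exact this

/-! ### Greedy minimality and uniqueness -/

theorem IsGolombAdmissible.le_of_le {r : ℕ} {a : ℤ → ℤ} (h : IsGolombAdmissible r a) {m n : ℤ}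
    (hm : 1 ≤ m) (hmn : m ≤ n) : a m ≤ a n := by
  induction n, hmn using Int.leInduction with
  | base => exact le_rfl
  | succ n hn ih => exact ih.trans (h.mono n (hm.trans hn))

theorem IsGolombAdmissible.apply_one {a : ℤ → ℤ} (h : IsGolombAdmissible 4 a) : a 1 = 1 := by
  have hw := h.window 1 le_rfl
  have hpos := h.pos 1 le_rfl
  norm_num [windowSum_four, h.eq_zero] at hw
  have := h.le_of_le le_rfl (show 1 ≤ a 1 by omega)
  omega

theorem golombFour_isAlmostGolomb : IsAlmostGolomb 4 golombFour where
  admissible := golombFour_admissible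
  minimal n hn b hb heq := by
    rcases hn.eq_or_lt with rfl | hn
    · rw [golombFour_two]
      by_contra hlt
      have hpos := hb.pos 2 (by norm_num)
      have h2 : b 2 = 1 := by omega
      have hw := hb.window 2 (by norm_num)
      norm_num [windowSum_four, hb.eq_zero, hb.apply_one, h2] at hw
    · have hbr := (golombFour_bracket (show 3 ≤ n by omega)).1
      have hjn : golombFour n < n := by
        rcases (show 3 ≤ n by omega).eq_or_lt with rfl | h4
        · norm_num [golombFour_three]
        · linarith [golombFour_add_two_le (show 4 ≤ n by omega)]
      have hj : 1 ≤ golombFour n := golombFour_admissible.pos n (by omega)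
      -- The window ends at a(n) < n, where b agrees with a. So b takes the value a(n) at an index
      -- at most n, and monotonicity finishes.
      have hws : windowSum 4 b (golombFour n) = windowSum 4 golombFour (golombFour n) := by
        rw [windowSum_four, windowSum_four, heq _ hjn, heq _ (by omega), heq _ (by omega),
          heq _ (by omega)]
      have hval := hb.window _ hj
      have hw1 : 1 ≤ windowSum 4 b (golombFour n) := by
        by_contra hneg
        rw [hb.eq_zero _ (by omega)] at hval
        omega
      have := hb.le_of_le hw1 (hws.le.trans hbr)
      omega

theorem IsAlmostGolomb.eq {a b : ℤ → ℤ} (ha : IsAlmostGolomb 4 a) (hb : IsAlmostGolomb 4 b) :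
    a = b := by
  funext n
  induction n using Int.strongRec (m := 2) with
  | lt n h =>
    rcases (show n ≤ 0 ∨ n = 1 by omega) with h0 | rfl
    · rw [ha.admissible.eq_zero n h0, hb.admissible.eq_zero n h0]
    · rw [ha.admissible.apply_one, hb.admissible.apply_one]
  | ge n h ih =>
    exact le_antisymm (ha.minimal n h b hb.admissible fun k hk => (ih k hk).symm)
      (hb.minimal n h a ha.admissible ih)

/-! ### Self-similarity under n ↦ 4n -/

theorem golombFour_eq_of_window {m j : ℤ} (i₀ i₁ i₂ i₄ : ℤ) (hm : 3 ≤ m)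
    (h₀ : i₀ = j - 3) (h₁ : i₁ = j - 2) (h₂ : i₂ = j - 1) (h₄ : i₄ = j + 1)
    (hle : golombFour j + golombFour i₂ + golombFour i₁ + golombFour i₀ ≤ m)
    (hlt : m < golombFour i₄ + golombFour j + golombFour i₂ + golombFour i₁) :
    golombFour m = j := by
  subst h₀ h₁ h₂ h₄
  refine golombFour_eq_of_bracket hm (by rwa [windowSum_four]) ?_
  rw [windowSum_four_succ, windowSum_four]
  linarith

/-- The local shape of the sequence around an index `n` with value `A`. -/
structure IsGolombWindow (n A t : ℤ) : Prop where
  five_left : golombFour (n - 5) = A - 3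
  four_left : golombFour (n - 4) = A - 2
  three_left : golombFour (n - 3) = A - 2
  two_left : golombFour (n - 2) = A - 1
  one_left : golombFour (n - 1) = A - 1
  center : golombFour n = A
  one_right : golombFour (n + 1) = A
  two_right : golombFour (n + 2) = A + t
  three_right : golombFour (n + 3) = A + 1

/-- The bracket is applied twice: values near n give those near 4A, and these give the values near
4n. The sum (n-1) + n + n + (n+1) = 4n is the window sum at 4A - 2. The next one is 4n + 3 - t, so
a(4n+2) exceeds a(4n) by t again. -/
theorem IsGolombWindow.four_mul {n A t : ℤ} (h : IsGolombWindow n A t) (ht : t = 0 ∨ t = 1)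
    (hn : 2 ≤ n) (hA : 3 ≤ A) : IsGolombWindow (4 * n) (4 * A - 2) t := by
  obtain ⟨p5, p4, p3, p2, p1, p0, r1, r2, r3⟩ := h
  have q8 : golombFour (4 * A - 8) = n - 2 :=
    golombFour_eq_of_window (n - 5) (n - 4) (n - 3) (n - 1) (by omega) (by ring) (by ring)
      (by ring) (by ring) (by omega) (by omega)
  have q7 : golombFour (4 * A - 7) = n - 2 :=
    golombFour_eq_of_window (n - 5) (n - 4) (n - 3) (n - 1) (by omega) (by ring) (by ring)
      (by ring) (by ring) (by omega) (by omega)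
  have q6 : golombFour (4 * A - 6) = n - 1 :=
    golombFour_eq_of_window (n - 4) (n - 3) (n - 2) n (by omega) (by ring) (by ring)
      (by ring) (by ring) (by omega) (by omega)
  have q5 : golombFour (4 * A - 5) = n - 1 :=
    golombFour_eq_of_window (n - 4) (n - 3) (n - 2) n (by omega) (by ring) (by ring)
      (by ring) (by ring) (by omega) (by omega)
  have q4 : golombFour (4 * A - 4) = n :=
    golombFour_eq_of_window (n - 3) (n - 2) (n - 1) (n + 1) (by omega) (by ring) (by ring)
      (by ring) (by ring) (by omega) (by omega)
  have q3 : golombFour (4 * A - 3) = n :=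
    golombFour_eq_of_window (n - 3) (n - 2) (n - 1) (n + 1) (by omega) (by ring) (by ring)
      (by ring) (by ring) (by omega) (by omega)
  have q2 : golombFour (4 * A - 2) = n + 1 :=
    golombFour_eq_of_window (n - 2) (n - 1) n (n + 2) (by omega) (by ring) (by ring)
      (by ring) (by ring) (by omega) (by omega)
  have q1 : golombFour (4 * A - 1) = n + 2 - t := by
    rcases ht with rfl | rfl
    · exact golombFour_eq_of_window (n - 1) n (n + 1) (n + 3) (by omega) (by ring) (by ring)
        (by ring) (by ring) (by simp only [sub_zero]; omega) (by simp only [sub_zero]; omega)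
    · rw [show n + 2 - 1 = n + 1 by ring]
      exact golombFour_eq_of_window (n - 2) (n - 1) n (n + 2) (by omega) (by ring) (by ring)
        (by ring) (by ring) (by omega) (by omega)
  have q0 : golombFour (4 * A) = n + 2 :=
    golombFour_eq_of_window (n - 1) n (n + 1) (n + 3) (by omega) (by ring) (by ring)
      (by ring) (by ring) (by omega) (by omega)
  refine ⟨?_, ?_, ?_, ?_, ?_, ?_, ?_, ?_, ?_⟩
  · rw [show 4 * A - 2 - 3 = 4 * A - 5 by ring]
    exact golombFour_eq_of_window (4 * A - 8) (4 * A - 7) (4 * A - 6) (4 * A - 4) (by omega)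
      (by ring) (by ring) (by ring) (by ring) (by omega) (by omega)
  · rw [show 4 * A - 2 - 2 = 4 * A - 4 by ring]
    exact golombFour_eq_of_window (4 * A - 7) (4 * A - 6) (4 * A - 5) (4 * A - 3) (by omega)
      (by ring) (by ring) (by ring) (by ring) (by omega) (by omega)
  · rw [show 4 * A - 2 - 2 = 4 * A - 4 by ring]
    exact golombFour_eq_of_window (4 * A - 7) (4 * A - 6) (4 * A - 5) (4 * A - 3) (by omega)
      (by ring) (by ring) (by ring) (by ring) (by omega) (by omega)
  · rw [show 4 * A - 2 - 1 = 4 * A - 3 by ring]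
    exact golombFour_eq_of_window (4 * A - 6) (4 * A - 5) (4 * A - 4) (4 * A - 2) (by omega)
      (by ring) (by ring) (by ring) (by ring) (by omega) (by omega)
  · rw [show 4 * A - 2 - 1 = 4 * A - 3 by ring]
    exact golombFour_eq_of_window (4 * A - 6) (4 * A - 5) (4 * A - 4) (4 * A - 2) (by omega)
      (by ring) (by ring) (by ring) (by ring) (by omega) (by omega)
  · exact golombFour_eq_of_window (4 * A - 5) (4 * A - 4) (4 * A - 3) (4 * A - 1) (by omega)
      (by ring) (by ring) (by ring) (by ring) (by omega) (by omega)
  · exact golombFour_eq_of_window (4 * A - 5) (4 * A - 4) (4 * A - 3) (4 * A - 1) (by omega)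
      (by ring) (by ring) (by ring) (by ring) (by omega) (by omega)
  · rcases ht with rfl | rfl
    · rw [add_zero]
      exact golombFour_eq_of_window (4 * A - 5) (4 * A - 4) (4 * A - 3) (4 * A - 1) (by omega)
        (by ring) (by ring) (by ring) (by ring) (by omega) (by omega)
    · rw [show 4 * A - 2 + 1 = 4 * A - 1 by ring]
      exact golombFour_eq_of_window (4 * A - 4) (4 * A - 3) (4 * A - 2) (4 * A) (by omega)
        (by ring) (by ring) (by ring) (by ring) (by omega) (by omega)
  · rw [show 4 * A - 2 + 1 = 4 * A - 1 by ring]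
    exact golombFour_eq_of_window (4 * A - 4) (4 * A - 3) (4 * A - 2) (4 * A) (by omega)
      (by ring) (by ring) (by ring) (by ring) (by omega) (by omega)

theorem isGolombWindow_base : IsGolombWindow 16 9 0 ∧ IsGolombWindow 28 14 1 := by
  have next {m x y : ℤ} (hm : 4 ≤ m) (hx : golombFour m = x)
      (hy : y = if golombFour (x + 1) + golombFour x + golombFour (x - 1) + golombFour (x - 2)
        ≤ m + 1 then x + 1 else x) : golombFour (m + 1) = y := by
    rw [golombFour_succ hm, hx, windowSum_four, hy, show x + 1 - 1 = x by ring,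
      show x + 1 - 2 = x - 1 by ring, show x + 1 - 3 = x - 2 by ring]
  have a1 := golombFour_one
  have a2 := golombFour_two
  have a3 := golombFour_three
  have a4 := golombFour_four
  have a5 := golombFour_five
  have a6 := golombFour_six
  have a7 : golombFour 7 = 4 := next (by norm_num) a6 (by norm_num [*])
  have a8 : golombFour 8 = 4 := next (by norm_num) a7 (by norm_num [*])
  have a9 : golombFour 9 = 5 := next (by norm_num) a8 (by norm_num [*])
  have a10 : golombFour 10 = 6 := next (by norm_num) a9 (by norm_num [*])
  have a11 : golombFour 11 = 6 := next (by norm_num) a10 (by norm_num [*])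
  have a12 : golombFour 12 = 7 := next (by norm_num) a11 (by norm_num [*])
  have a13 : golombFour 13 = 7 := next (by norm_num) a12 (by norm_num [*])
  have a14 : golombFour 14 = 8 := next (by norm_num) a13 (by norm_num [*])
  have a15 : golombFour 15 = 8 := next (by norm_num) a14 (by norm_num [*])
  have a16 : golombFour 16 = 9 := next (by norm_num) a15 (by norm_num [*])
  have a17 : golombFour 17 = 9 := next (by norm_num) a16 (by norm_num [*])
  have a18 : golombFour 18 = 9 := next (by norm_num) a17 (by norm_num [*])
  have a19 : golombFour 19 = 10 := next (by norm_num) a18 (by norm_num [*])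
  have a20 : golombFour 20 = 10 := next (by norm_num) a19 (by norm_num [*])
  have a21 : golombFour 21 = 11 := next (by norm_num) a20 (by norm_num [*])
  have a22 : golombFour 22 = 11 := next (by norm_num) a21 (by norm_num [*])
  have a23 : golombFour 23 = 11 := next (by norm_num) a22 (by norm_num [*])
  have a24 : golombFour 24 = 12 := next (by norm_num) a23 (by norm_num [*])
  have a25 : golombFour 25 = 12 := next (by norm_num) a24 (by norm_num [*])
  have a26 : golombFour 26 = 13 := next (by norm_num) a25 (by norm_num [*])
  have a27 : golombFour 27 = 13 := next (by norm_num) a26 (by norm_num [*])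
  have a28 : golombFour 28 = 14 := next (by norm_num) a27 (by norm_num [*])
  have a29 : golombFour 29 = 14 := next (by norm_num) a28 (by norm_num [*])
  have a30 : golombFour 30 = 15 := next (by norm_num) a29 (by norm_num [*])
  have a31 : golombFour 31 = 15 := next (by norm_num) a30 (by norm_num [*])
  constructor <;> constructor <;> norm_num [*]

theorem IsGolombWindow.four_pow {n A t : ℤ} (h : IsGolombWindow n A t) (ht : t = 0 ∨ t = 1)
    (hn : 2 ≤ n) (hA : 3 ≤ A) (k : ℕ) :
    3 * golombFour (n * 4 ^ k) = (3 * A - 2) * 4 ^ k + 2 := by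
  induction k generalizing n A with
  | zero => simp [h.center]
  | succ k ih =>
    have := ih (h.four_mul ht hn hA) (by omega) (by omega)
    rw [pow_succ', show n * (4 * 4 ^ k) = 4 * n * 4 ^ k by ring, this]
    ring

theorem golombFour_four_pow {k : ℕ} (hk : 2 ≤ k) :
    48 * golombFour (4 ^ k) = 25 * 4 ^ k + 32 := by
  obtain ⟨j, rfl⟩ := Nat.exists_eq_add_of_le hk
  have := isGolombWindow_base.1.four_pow (Or.inl rfl) (by norm_num) (by norm_num) j
  rw [pow_add, show (4 : ℤ) ^ 2 = 16 by norm_num]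
  linarith

theorem golombFour_seven_mul_four_pow {k : ℕ} (hk : 1 ≤ k) :
    3 * golombFour (7 * 4 ^ k) = 10 * 4 ^ k + 2 := by
  obtain ⟨j, rfl⟩ := Nat.exists_eq_add_of_le hk
  have := isGolombWindow_base.2.four_pow (Or.inr rfl) (by norm_num) (by norm_num) j
  rw [pow_add, show (7 : ℤ) * (4 ^ 1 * 4 ^ j) = 28 * 4 ^ j by ring]
  linarith

/-! ### Limits along the two subsequences -/

theorem tendsto_const_add_div_four_pow (c d : ℝ) :
    Tendsto (fun k : ℕ => c + d / (4 : ℝ) ^ k) atTop (𝓝 c) := by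
  have h : Tendsto (fun k : ℕ => d / (4 : ℝ) ^ k) atTop (𝓝 0) :=
    (tendsto_pow_atTop_atTop_of_one_lt (by norm_num)).const_div_atTop d
  simpa using h.const_add c

theorem mainTheorem9 :
    (∃! a : ℤ → ℤ, IsAlmostGolomb 4 a) ∧
    ∀ a : ℤ → ℤ, IsAlmostGolomb 4 a →
      (∀ k : ℕ, 3 ≤ k → a (4 ^ (k + 1)) = 4 * a (4 ^ k) - 2) ∧
      (∀ k : ℕ, 3 ≤ k → (a (4 ^ k) : ℝ) = 25 / 48 * (4 : ℝ) ^ k + 2 / 3) ∧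
      Tendsto (fun k : ℕ => (a (4 ^ k) : ℝ) / (4 : ℝ) ^ k) atTop (𝓝 (25 / 48)) ∧
      Tendsto (fun k : ℕ => (a (7 * 4 ^ k) : ℝ) / (7 * (4 : ℝ) ^ k)) atTop (𝓝 (10 / 21)) ∧
      (25 / 48 : ℝ) ≠ 10 / 21 ∧
      MapClusterPt (25 / 48 : ℝ) atTop (fun n : ℕ => (a (n : ℤ) : ℝ) / (n : ℝ)) ∧
      MapClusterPt (10 / 21 : ℝ) atTop (fun n : ℕ => (a (n : ℤ) : ℝ) / (n : ℝ)) ∧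
      ¬ ∃ L : ℝ, Tendsto (fun n : ℕ => (a (n : ℤ) : ℝ) / (n : ℝ)) atTop (𝓝 L) := by
  refine ⟨⟨golombFour, golombFour_isAlmostGolomb, fun b hb => hb.eq golombFour_isAlmostGolomb⟩, ?_⟩
  intro a ha
  obtain rfl := ha.eq golombFour_isAlmostGolomb
  have hval (k : ℕ) (hk : 2 ≤ k) :
      (golombFour (4 ^ k) : ℝ) = 25 / 48 * (4 : ℝ) ^ k + 2 / 3 := by
    have h : (48 * golombFour (4 ^ k) : ℝ) = 25 * 4 ^ k + 32 := mod_cast golombFour_four_pow hk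
    linarith
  have hval7 (k : ℕ) (hk : 1 ≤ k) :
      (golombFour (7 * 4 ^ k) : ℝ) = 10 / 3 * (4 : ℝ) ^ k + 2 / 3 := by
    have h : (3 * golombFour (7 * 4 ^ k) : ℝ) = 10 * 4 ^ k + 2 :=
      mod_cast golombFour_seven_mul_four_pow hk
    linarith
  have hlim : Tendsto (fun k : ℕ => (golombFour (4 ^ k) : ℝ) / (4 : ℝ) ^ k) atTop
      (𝓝 (25 / 48)) := by
    refine (tendsto_const_add_div_four_pow (25 / 48) (2 / 3)).congr' ?_
    filter_upwards [eventually_ge_atTop 2] with k hk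
    rw [hval k hk]
    field_simp
  have hlim7 : Tendsto (fun k : ℕ => (golombFour (7 * 4 ^ k) : ℝ) / (7 * (4 : ℝ) ^ k)) atTop
      (𝓝 (10 / 21)) := by
    refine (tendsto_const_add_div_four_pow (10 / 21) (2 / 21)).congr' ?_
    filter_upwards [eventually_ge_atTop 1] with k hk
    rw [hval7 k hk]
    field_simp
    ring
  have hpow : Tendsto (fun k : ℕ => 4 ^ k) atTop (atTop : Filter ℕ) :=
    tendsto_pow_atTop_atTop_of_one_lt (by norm_num)
  have hpow7 : Tendsto (fun k : ℕ => 7 * 4 ^ k) atTop (atTop : Filter ℕ) :=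
    hpow.const_mul_atTop' (by norm_num)
  have hsub : Tendsto ((fun n : ℕ => (golombFour (n : ℤ) : ℝ) / (n : ℝ)) ∘ fun k : ℕ => 4 ^ k)
      atTop (𝓝 (25 / 48)) := by
    refine hlim.congr fun k => ?_
    simp
  have hsub7 : Tendsto
      ((fun n : ℕ => (golombFour (n : ℤ) : ℝ) / (n : ℝ)) ∘ fun k : ℕ => 7 * 4 ^ k)
      atTop (𝓝 (10 / 21)) := by
    refine hlim7.congr fun k => ?_
    simp
  have hne : (25 / 48 : ℝ) ≠ 10 / 21 := by norm_num
  refine ⟨fun k hk => ?_, fun k hk => hval k (by omega), hlim, hlim7, hne,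
    MapClusterPt.of_comp hpow hsub.mapClusterPt, MapClusterPt.of_comp hpow7 hsub7.mapClusterPt, ?_⟩
  · have h1 := golombFour_four_pow (show 2 ≤ k by omega)
    have h2 := golombFour_four_pow (show 2 ≤ k + 1 by omega)
    rw [pow_succ (4 : ℤ) k] at h2 ⊢
    linarith
  · rintro ⟨L, hL⟩
    exact hne ((tendsto_nhds_unique hsub (hL.comp hpow)).trans
      (tendsto_nhds_unique (hL.comp hpow7) hsub7))
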